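/- Let $\mathbb{RUNO}1$ be the variety of all algebras $\langle A,\vee,\wedge,\to,{}',0,1\rangle$ such that $\langle A,\vee,\wedge,0,1\rangle$ is a bounded lattice and, writing $x^*:=x\to 0$, the following hold for all $x,y,z\in A$: $x\wedge(x\to y)=x\wedge y$; $\;x\wedge(y\to z)=x\wedge[(x\wedge y)\to(x\wedge z)]$; $\;x\to x=1$; $\;0'=1$; $\;1'=0$; $\;(x\wedge y)'=x'\vee y'$; $\;x''=x$; $\;(0\to1)'=0\to1$; $\;x\wedge x'^{*}{}'\le y\vee y^*$; $\;x\wedge x'^*=(x\wedge x'^*)'^*$. These are the regular unorthodox De Morgan semi-Heyting algebras of level 1. Every subvariety $\mathbb V$ of $\mathbb{RUNO}1$ (that is, every class $\mathbb V\subseteq\mathbb{RUNO}1$ closed under homomorphic images, subalgebras and arbitrary direct products) has the amalgamation property: for all $\mathbf A,\mathbf B,\mathbf C\in\mathbb V$ and all embeddings $f:\mathbf A\to\mathbf B$ and $g:\mathbf A\to\mathbf C$ there are $\mathbf D\in\mathbb V$ and embeddings $f_1:\mathbf B\to\mathbf D$ and $g_1:\mathbf C\to\mathbf D$ with $f_1\circ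 f=g_1\circ g$. -/

import Mathlib

universe u

/-- Algebras in the language `⟨∨, ∧, →, ', 0, 1⟩`: six operations, no laws.
`x ⊔ y`, `x ⊓ y`, `x ⇨ y`, `⊥`, `⊤` are `x ∨ y`, `x ∧ y`, `x → y`, `0`, `1`; `dneg x` is `x'`. -/
class LAlgebra (A : Type u) extends Max A, Min A, HImp A, Bot A, Top A where
  dneg : A → A

namespace LAlgebra

/-- The derived unary operation `x* := x → 0`. -/
def star {A : Type u} [LAlgebra A] (x : A) : A := x ⇨ ⊥

/-- The operations of a direct product are computed coordinatewise. -/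
instance instPi {ι : Type u} {A : ι → Type u} [∀ i, LAlgebra (A i)] :
    LAlgebra (∀ i, A i) where
  max x y := fun i => x i ⊔ y i
  min x y := fun i => x i ⊓ y i
  himp x y := fun i => x i ⇨ y i
  bot := fun _ => ⊥
  top := fun _ => ⊤
  dneg x := fun i => dneg (x i)

/-- Homomorphisms: maps that preserve all six operations. -/
structure IsHom {A B : Type u} [LAlgebra A] [LAlgebra B] (f : A → B) : Prop where
  map_sup : ∀ x y, f (x ⊔ y) = f x ⊔ f y
  map_inf : ∀ x y, f (x ⊓ y) = f x ⊓ f y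
  map_himp : ∀ x y, f (x ⇨ y) = f x ⇨ f y
  map_bot : f ⊥ = ⊥
  map_top : f ⊤ = ⊤
  map_dneg : ∀ x, f (dneg x) = dneg (f x)

/-- Embeddings: injective homomorphisms. -/
structure IsEmbedding {A B : Type u} [LAlgebra A] [LAlgebra B] (f : A → B) : Prop
    extends IsHom f where
  injective : Function.Injective f

/-- The lattice laws, with `0` the least and `1` the greatest element. -/
structure IsBoundedLattice (A : Type u) [LAlgebra A] : Prop where
  sup_comm : ∀ x y : A, x ⊔ y = y ⊔ x
  inf_comm : ∀ x y : A, x ⊓ y = y ⊓ x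
  sup_assoc : ∀ x y z : A, (x ⊔ y) ⊔ z = x ⊔ (y ⊔ z)
  inf_assoc : ∀ x y z : A, (x ⊓ y) ⊓ z = x ⊓ (y ⊓ z)
  sup_inf_self : ∀ x y : A, x ⊔ (x ⊓ y) = x
  inf_sup_self : ∀ x y : A, x ⊓ (x ⊔ y) = x
  bot_inf : ∀ x : A, ⊥ ⊓ x = ⊥
  top_sup : ∀ x : A, ⊤ ⊔ x = ⊤

structure IsSemiHeyting (A : Type u) [LAlgebra A] : Prop extends IsBoundedLattice A where
  inf_himp : ∀ x y : A, x ⊓ (x ⇨ y) = x ⊓ y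
  inf_himp_inf : ∀ x y z : A, x ⊓ (y ⇨ z) = x ⊓ ((x ⊓ y) ⇨ (x ⊓ z))
  himp_self : ∀ x : A, x ⇨ x = ⊤

/-- Dually hemimorphic semi-Heyting algebras. -/
structure IsDHMSH (A : Type u) [LAlgebra A] : Prop extends IsSemiHeyting A where
  dneg_bot : dneg (⊥ : A) = ⊤
  dneg_top : dneg (⊤ : A) = ⊥
  dneg_inf : ∀ x y : A, dneg (x ⊓ y) = dneg x ⊔ dneg y

/-- Dually quasi-De Morgan semi-Heyting algebras; the inequality `x'' ≤ x` is written as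
`x'' ∧ x = x''`. -/
structure IsDQDSH (A : Type u) [LAlgebra A] : Prop extends IsDHMSH A where
  dneg_dneg_sup : ∀ x y : A, dneg (dneg (x ⊔ y)) = dneg (dneg x) ⊔ dneg (dneg y)
  dneg_dneg_le : ∀ x : A, dneg (dneg x) ⊓ x = dneg (dneg x)

/-- De Morgan semi-Heyting algebras. -/
structure IsDMSH (A : Type u) [LAlgebra A] : Prop extends IsDQDSH A where
  dneg_dneg : ∀ x : A, dneg (dneg x) = x

/-- Unorthodox De Morgan semi-Heyting algebras. -/
structure IsUNO (A : Type u) [LAlgebra A] : Prop extends IsDMSH A where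
  unorthodox : dneg ((⊥ : A) ⇨ ⊤) = ⊥ ⇨ ⊤

/-- Regular unorthodox algebras: `x ∧ x'*' ≤ y ∨ y*`, where `u ≤ v` is `u ∧ v = u`. -/
structure IsRUNO (A : Type u) [LAlgebra A] : Prop extends IsUNO A where
  regular : ∀ x y : A,
    (x ⊓ dneg (star (dneg x))) ⊓ (y ⊔ star y) = x ⊓ dneg (star (dneg x))

/-- Regular unorthodox algebras of level 1: `x ∧ x'* = (x ∧ x'*)'*`. -/
structure IsRUNO1 (A : Type u) [LAlgebra A] : Prop extends IsRUNO A where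
  level_one : ∀ x : A, x ⊓ star (dneg x) = star (dneg (x ⊓ star (dneg x)))

/-- Bundled algebras in the language `⟨∨, ∧, →, ', 0, 1⟩`. -/
structure Alg where
  carrier : Type u
  [str : LAlgebra carrier]

attribute [instance] Alg.str

instance : CoeSort Alg.{u} (Type u) := ⟨Alg.carrier⟩

/-- The class of regular unorthodox De Morgan semi-Heyting algebras of level 1. -/
def RUNO1 : Set Alg.{u} := {A | IsRUNO1 A}

/-- A variety: a class of algebras closed under homomorphic images, subalgebras (up to
isomorphism) and direct products of arbitrary, possibly empty, families. -/
structure IsVariety (V : Set Alg.{u}) : Prop where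
  homImage : ∀ (A B : Alg.{u}) (f : A → B),
    A ∈ V → IsHom f → Function.Surjective f → B ∈ V
  subalgebra : ∀ (A B : Alg.{u}) (f : A → B), B ∈ V → IsEmbedding f → A ∈ V
  product : ∀ (ι : Type u) (A : ι → Alg.{u}),
    (∀ i, A i ∈ V) → (⟨∀ i, A i⟩ : Alg.{u}) ∈ V

/-- `V` is a subvariety of the class `W`. -/
def IsSubvariety (V W : Set Alg.{u}) : Prop := IsVariety V ∧ V ⊆ W

/-- The amalgamation property of a class of algebras. -/
def HasAP (K : Set Alg.{u}) : Prop :=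
  ∀ (A B C : Alg.{u}) (f : A → B) (g : A → C),
    A ∈ K → B ∈ K → C ∈ K → IsEmbedding f → IsEmbedding g →
    ∃ (D : Alg.{u}) (f₁ : B → D) (g₁ : C → D),
      D ∈ K ∧ IsEmbedding f₁ ∧ IsEmbedding g₁ ∧ f₁ ∘ f = g₁ ∘ g

end LAlgebra

/-! The element `core x` = x ∧ x'* is central: its image under ' is a complement. Every filter of
central elements induces a congruence, and the central elements outside a prime ideal give a simple
quotient, so homomorphisms to simple members of V separate points
(`exists_isCoreSimple_separating`). In a simple algebra every element is one of the constants 0, 1,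
0 → 1, (0 → 1)* (`IsRUNO1.eq_constant`), hence every homomorphism into it is onto. This lets any
homomorphism from A to a simple S extend along an embedding A → C (`exists_extension`): a suitable
simple quotient of C is already an image of A, and the map to S factors through it. The amalgam is
the product of the simple algebras obtained by separating all pairs of points of B and of C. -/

namespace LAlgebra

/-! ### Distributivity -/

section Lattice

variable {A : Type u} [LAlgebra A]

/-- The order of a bounded lattice in the language of `LAlgebra`. -/
@[reducible]
def IsBoundedLattice.toLattice (h : IsBoundedLattice A) : Lattice A :=
  Lattice.mk' h.sup_comm h.sup_assoc h.inf_comm h.inf_assoc h.sup_inf_self h.inf_sup_self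

/-- Semi-Heyting algebras are distributive: `y → (y ∧ z)` is the relative pseudocomplement
of `y` with respect to `z`. -/
@[reducible]
def IsSemiHeyting.toDistribLattice (h : IsSemiHeyting A) : DistribLattice A :=
  letI := h.toLattice
  DistribLattice.ofInfSupLe (fun a b c => by
    have key : ∀ x z : A, a ⊓ x ≤ z → x ≤ a ⇨ (a ⊓ z) := by
      intro x z hx
      have h1 := h.inf_himp_inf x a (a ⊓ z)
      have h2 : x ⊓ (a ⊓ z) = x ⊓ a := by
        rw [← inf_assoc]
        exact inf_eq_left.mpr (by rwa [inf_comm])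
      rw [h2, h.himp_self] at h1
      refine inf_eq_left.mp (h1.trans (inf_eq_left.mpr ?_))
      exact sup_eq_left.mp (h.top_sup x)
    have hbc := sup_le (key b (a ⊓ b ⊔ a ⊓ c) le_sup_left)
      (key c (a ⊓ b ⊔ a ⊓ c) le_sup_right)
    refine (inf_le_inf_left a hbc).trans ?_
    rw [h.inf_himp, ← inf_assoc, inf_idem]
    exact inf_le_right)

/-- The bounds of a bounded lattice in the language of `LAlgebra`. -/
@[reducible]
def IsSemiHeyting.toBoundedOrder (h : IsSemiHeyting A) :
    letI := h.toDistribLattice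
    BoundedOrder A :=
  letI := h.toDistribLattice
  { top := ⊤
    bot := ⊥
    le_top := fun x => sup_eq_left.mp (h.top_sup x)
    bot_le := fun x => inf_eq_left.mp (h.bot_inf x) }

end Lattice

/-! ### Central elements and the core -/

section Arithmetic

variable {A : Type u} [LAlgebra A]

theorem IsSemiHeyting.inf_star_self (h : IsSemiHeyting A) (x : A) : x ⊓ star x = ⊥ := by
  rw [star, h.inf_himp, h.inf_comm, h.bot_inf]

theorem IsSemiHeyting.inf_top (h : IsSemiHeyting A) (x : A) : x ⊓ ⊤ = x := by
  let := h.toDistribLattice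
  let := h.toBoundedOrder
  exact _root_.inf_top_eq x

theorem IsSemiHeyting.inf_star_of_inf_eq_bot (h : IsSemiHeyting A) {x y : A}
    (hxy : y ⊓ x = ⊥) : y ⊓ star x = y := by
  rw [star, h.inf_himp_inf, hxy, h.inf_comm y ⊥, h.bot_inf, h.himp_self, h.inf_top]

theorem IsSemiHeyting.star_bot (h : IsSemiHeyting A) : star (⊥ : A) = ⊤ := h.himp_self ⊥

theorem IsDMSH.dneg_sup (h : IsDMSH A) (x y : A) : dneg (x ⊔ y) = dneg x ⊓ dneg y := by
  rw [← h.dneg_dneg (dneg x ⊓ dneg y), h.dneg_inf, h.dneg_dneg, h.dneg_dneg]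

/-- The equivalence `(x → y) ∧ (y → x)`. -/
def biimp (x y : A) : A := (x ⇨ y) ⊓ (y ⇨ x)

theorem IsSemiHeyting.inf_biimp (h : IsSemiHeyting A) (x y : A) :
    x ⊓ biimp x y = y ⊓ biimp x y := by
  let := h.toDistribLattice
  have h1 : x ⊓ biimp x y = x ⊓ y := by
    rw [biimp, ← inf_assoc, h.inf_himp, inf_assoc, h.inf_himp, inf_comm y x, ← inf_assoc,
      inf_idem]
  have h2 : y ⊓ biimp x y = x ⊓ y := by
    rw [biimp, inf_comm (x ⇨ y), ← inf_assoc, h.inf_himp, inf_assoc, h.inf_himp,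
      inf_comm y, inf_assoc, inf_idem]
  rw [h1, h2]

theorem IsSemiHeyting.biimp_self (h : IsSemiHeyting A) (x : A) : biimp x x = ⊤ := by
  rw [biimp, h.himp_self, h.inf_top]

theorem IsSemiHeyting.eq_of_biimp_eq_top (h : IsSemiHeyting A) {x y : A}
    (hxy : biimp x y = ⊤) : x = y := by
  have := h.inf_biimp x y
  rwa [hxy, h.inf_top, h.inf_top] at this

/-- An element is central if `x'` is a complement of `x`. -/
def IsCentral (x : A) : Prop := x ⊓ dneg x = ⊥

/-- The largest central element below `x` in an algebra of level 1. -/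
def core (x : A) : A := x ⊓ star (dneg x)

/-- Level 1 makes the core c a fixed point of c ↦ c'*, and c' ∧ c'* = 0. -/
theorem IsRUNO1.isCentral_core (h : IsRUNO1 A) (x : A) : IsCentral (core x) := by
  have h1 := h.level_one x
  change core x = star (dneg (core x)) at h1
  have h2 := h.inf_star_self (dneg (core x))
  rw [← h1] at h2
  rw [IsCentral, h.inf_comm]
  exact h2

theorem IsDMSH.isCentral_dneg (h : IsDMSH A) {x : A} (hx : IsCentral x) :
    IsCentral (dneg x) := by
  rw [IsCentral, h.dneg_dneg, h.inf_comm]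
  exact hx

theorem IsDMSH.isCentral_top (h : IsDMSH A) : IsCentral (⊤ : A) := by
  rw [IsCentral, h.dneg_top, h.inf_comm, h.bot_inf]

theorem IsDMSH.isCentral_inf (h : IsDMSH A) {x y : A} (hx : IsCentral x) (hy : IsCentral y) :
    IsCentral (x ⊓ y) := by
  let := h.toDistribLattice
  let := h.toBoundedOrder
  unfold IsCentral at *
  rw [h.dneg_inf, inf_sup_left, inf_assoc x y (dneg y), hy, inf_comm x y, inf_assoc, hx]
  change y ⊓ ⊥ ⊔ x ⊓ ⊥ = ⊥
  simp

theorem IsDMSH.core_top (h : IsDMSH A) : core (⊤ : A) = ⊤ := by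
  rw [core, h.dneg_top, h.star_bot, h.inf_top]

theorem IsSemiHeyting.core_inf_self (h : IsSemiHeyting A) (x : A) : x ⊓ core x = core x := by
  let := h.toDistribLattice
  rw [core, ← inf_assoc, inf_idem]

end Arithmetic

/-! ### Homomorphisms -/

section Hom

variable {A B C : Type u} [LAlgebra A] [LAlgebra B] [LAlgebra C]

theorem IsHom.comp {g : B → C} {f : A → B} (hg : IsHom g) (hf : IsHom f) : IsHom (g ∘ f) where
  map_sup x y := by simp [hf.map_sup, hg.map_sup]
  map_inf x y := by simp [hf.map_inf, hg.map_inf]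
  map_himp x y := by simp [hf.map_himp, hg.map_himp]
  map_bot := by simp [hf.map_bot, hg.map_bot]
  map_top := by simp [hf.map_top, hg.map_top]
  map_dneg x := by simp [hf.map_dneg, hg.map_dneg]

theorem IsHom.map_star {f : A → B} (hf : IsHom f) (x : A) : f (star x) = star (f x) := by
  rw [star, star, hf.map_himp, hf.map_bot]

theorem IsHom.map_core {f : A → B} (hf : IsHom f) (x : A) : f (core x) = core (f x) := by
  rw [core, core, hf.map_inf, hf.map_star, hf.map_dneg]

theorem IsHom.map_biimp {f : A → B} (hf : IsHom f) (x y : A) :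
    f (biimp x y) = biimp (f x) (f y) := by
  rw [biimp, biimp, hf.map_inf, hf.map_himp, hf.map_himp]

theorem IsHom.map_isCentral {f : A → B} (hf : IsHom f) {x : A} (hx : IsCentral x) :
    IsCentral (f x) := by
  rw [IsCentral, ← hf.map_dneg, ← hf.map_inf, hx, hf.map_bot]

/-- A homomorphism factors through every surjective homomorphism with a smaller kernel. -/
theorem IsHom.exists_factor {p : A → B} {u : A → C} (hp : IsHom p) (hu : IsHom u)
    (hs : Function.Surjective p) (hk : ∀ x y, p x = p y → u x = u y) :
    ∃ k : B → C, IsHom k ∧ k ∘ p = u := by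
  obtain ⟨s, hs⟩ := hs.hasRightInverse
  have key : ∀ x, u (s (p x)) = u x := fun x => hk _ _ (hs _)
  refine ⟨u ∘ s, ⟨fun x y => ?_, fun x y => ?_, fun x y => ?_, ?_, ?_, fun x => ?_⟩, funext key⟩
  · rw [← hs x, ← hs y, ← hp.map_sup]
    simp only [Function.comp, key, hu.map_sup]
  · rw [← hs x, ← hs y, ← hp.map_inf]
    simp only [Function.comp, key, hu.map_inf]
  · rw [← hs x, ← hs y, ← hp.map_himp]
    simp only [Function.comp, key, hu.map_himp]
  · rw [← hp.map_bot]
    simp only [Function.comp, key, hu.map_bot]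
  · rw [← hp.map_top]
    simp only [Function.comp, key, hu.map_top]
  · rw [← hs x, ← hp.map_dneg]
    simp only [Function.comp, key, hu.map_dneg]

end Hom

/-! ### Simple algebras consist of constants -/

section Simple

/-- Nontrivial algebras in which `0` is the core of every element other than `1`; in level 1
these are the simple algebras. -/
structure IsCoreSimple (A : Type u) [LAlgebra A] : Prop where
  bot_ne_top : (⊥ : A) ≠ ⊤
  core_eq_bot : ∀ x : A, x ≠ ⊤ → core x = ⊥

variable {A : Type u} [LAlgebra A]

/-- Regularity at e reads e ≤ y ∨ y* for all y. If e ≤ y ≠ 1, then y' ≤ e, while e ∧ y'* ≤ `core y`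
= 0 forces e ≤ y'; so y = e. Applying this to (x ∧ e)' settles every x. -/
theorem IsRUNO.eq_constant_of_star_eq_bot (h : IsRUNO A) (hs : IsCoreSimple A) {e : A}
    (he : dneg e = e) (hc : star e = ⊥) (x : A) : x = ⊥ ∨ x = ⊤ ∨ x = e := by
  let := h.toDistribLattice
  let := h.toBoundedOrder
  have hle : ∀ y : A, e ≤ y ⊔ star y := by
    intro y
    have h1 := h.regular e y
    rw [he, hc, h.dneg_bot, h.inf_top] at h1
    exact inf_eq_left.mp h1
  have above : ∀ y : A, e ≤ y → y = ⊤ ∨ y = e := by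
    intro y hy
    by_cases hy1 : y = ⊤
    · exact Or.inl hy1
    right
    have h0 : y ⊓ star (dneg y) = ⊥ := hs.core_eq_bot y hy1
    have h1 : dneg y ≤ e := by
      have := h.dneg_sup e y
      rw [sup_eq_right.mpr hy, he] at this
      exact this.trans_le inf_le_left
    have h2 : e ⊓ star (dneg y) ≤ ⊥ := (inf_le_inf_right _ hy).trans h0.le
    have h3 : e ≤ dneg y := by
      have := le_inf le_rfl (hle (dneg y))
      rw [inf_sup_left] at this
      exact this.trans (sup_le inf_le_right (h2.trans bot_le))
    rw [← h.dneg_dneg y, le_antisymm h1 h3, he]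
  have hxe : e ≤ dneg (x ⊓ e) := by
    rw [h.dneg_inf, he]
    exact le_sup_right
  rcases above _ hxe with h1 | h1
  · left
    have h2 : x ⊓ e = ⊥ := by rw [← h.dneg_dneg (x ⊓ e), h1, h.dneg_top]
    have h3 := h.inf_star_of_inf_eq_bot h2
    rw [hc, h.inf_comm, h.bot_inf] at h3
    exact h3.symm
  · right
    have h2 : x ⊓ e = e := by rw [← h.dneg_dneg (x ⊓ e), h1, he]
    exact above x (inf_eq_right.mp h2)

/-- Here e and c = e* are complementary fixed points of ', and only 1 lies strictly above either of
them. -/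
theorem IsDMSH.eq_constant_of_star_ne_bot (h : IsDMSH A) (hs : IsCoreSimple A) {e : A}
    (he : dneg e = e) (hc : star e ≠ ⊥) (x : A) :
    x = ⊥ ∨ x = ⊤ ∨ x = e ∨ x = star e := by
  let := h.toDistribLattice
  let := h.toBoundedOrder
  set c := star e with hcdef
  have hec : e ⊓ c = ⊥ := h.inf_star_self e
  have hdec : e ⊔ c = ⊤ := by
    by_contra hne
    have h0 : (e ⊔ c) ⊓ star (dneg (e ⊔ c)) = ⊥ := hs.core_eq_bot _ hne
    have h1 : c ⊓ dneg (e ⊔ c) = ⊥ := by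
      rw [h.dneg_sup, he, ← inf_assoc, inf_comm c e, hec, h.bot_inf]
    -- So c would lie below the core of e ∨ c, which is 0.
    have h2 : c ≤ star (dneg (e ⊔ c)) := inf_eq_left.mp (h.inf_star_of_inf_eq_bot h1)
    exact hc (le_bot_iff.mp ((le_inf le_sup_right h2).trans h0.le))
  have hcc : dneg c = c := by
    have h1 : e ⊓ dneg c = ⊥ := by
      have := h.dneg_sup e c
      rw [hdec, he, h.dneg_top] at this
      exact this.symm
    have h2 : e ⊔ dneg c = ⊤ := by
      have := h.dneg_inf e c
      rw [hec, he, h.dneg_bot] at this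
      exact this.symm
    -- Complements of e are unique by distributivity.
    exact eq_of_inf_eq_sup_eq (a := e) (by rw [inf_comm (dneg c), h1, inf_comm c, hec])
      (by rw [sup_comm (dneg c), h2, sup_comm c, hdec])
  have above : ∀ a b y : A, dneg a = a → a ⊓ b = ⊥ → a ⊔ b = ⊤ → a ≤ y → y = ⊤ ∨ y = a := by
    intro a b y ha hab hab' hy
    by_cases hy1 : y = ⊤
    · exact Or.inl hy1
    right
    have h0 : y ⊓ star (dneg y) = ⊥ := hs.core_eq_bot y hy1
    have h1 : dneg y ≤ a := by
      have := h.dneg_sup a y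
      rw [sup_eq_right.mpr hy, ha] at this
      exact this.trans_le inf_le_left
    have h2 : b ⊓ dneg y = ⊥ := by
      refine le_bot_iff.mp ((inf_le_inf_left b h1).trans ?_)
      rw [inf_comm]
      exact hab.le
    have h3 : b ≤ star (dneg y) := inf_eq_left.mp (h.inf_star_of_inf_eq_bot h2)
    have h4 : y ⊓ b = ⊥ := le_bot_iff.mp ((inf_le_inf_left y h3).trans h0.le)
    calc y = y ⊓ (a ⊔ b) := by rw [hab', h.inf_top]
      _ = y ⊓ a := by
        rw [inf_sup_left, h4]
        exact sup_bot_eq _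
      _ = a := inf_eq_right.mpr hy
  have below : ∀ a b : A, dneg a = a → a ⊓ b = ⊥ → a ⊔ b = ⊤ → x ⊓ a = ⊥ ∨ x ⊓ a = a := by
    intro a b ha hab hab'
    have hxa : a ≤ dneg (x ⊓ a) := by
      rw [h.dneg_inf, ha]
      exact le_sup_right
    rcases above a b _ ha hab hab' hxa with h1 | h1
    · left
      rw [← h.dneg_dneg (x ⊓ a), h1, h.dneg_top]
    · right
      rw [← h.dneg_dneg (x ⊓ a), h1, ha]
  have hx : x = (x ⊓ e) ⊔ (x ⊓ c) := by rw [← inf_sup_left, hdec, h.inf_top]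
  have bot_sup : ∀ y : A, ⊥ ⊔ y = y := fun y => bot_sup_eq y
  rcases below e c he hec hdec with h1 | h1 <;>
    rcases below c e hcc (by rw [inf_comm, hec]) (by rw [sup_comm, hdec]) with h2 | h2 <;>
    rw [h1, h2] at hx
  · left
    rw [hx, bot_sup]
  · right; right; right
    rw [hx, bot_sup]
  · right; right; left
    rw [hx, sup_comm, bot_sup]
  · right; left
    rw [hx, hdec]

/-- In a simple algebra of `RUNO1` every element is the value of a constant term. -/
theorem IsRUNO1.eq_constant (h : IsRUNO1 A) (hs : IsCoreSimple A) (x : A) :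
    x = ⊥ ∨ x = ⊤ ∨ x = ⊥ ⇨ ⊤ ∨ x = star (⊥ ⇨ ⊤) := by
  by_cases hc : star ((⊥ : A) ⇨ ⊤) = ⊥
  · have := h.eq_constant_of_star_eq_bot hs h.unorthodox hc x
    tauto
  · exact h.eq_constant_of_star_ne_bot hs h.unorthodox hc x

theorem IsRUNO1.surjective_of_isCoreSimple {B : Type u} [LAlgebra B] (h : IsRUNO1 B)
    (hs : IsCoreSimple B) {f : A → B} (hf : IsHom f) : Function.Surjective f := by
  have he : f (⊥ ⇨ ⊤) = ⊥ ⇨ ⊤ := by rw [hf.map_himp, hf.map_bot, hf.map_top]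
  intro x
  rcases h.eq_constant hs x with rfl | rfl | rfl | rfl
  · exact ⟨⊥, hf.map_bot⟩
  · exact ⟨⊤, hf.map_top⟩
  · exact ⟨⊥ ⇨ ⊤, he⟩
  · exact ⟨star (⊥ ⇨ ⊤), by rw [hf.map_star, he]⟩

end Simple

/-! ### Simple quotients from central filters -/

section Quotient

variable {A : Type u} [LAlgebra A]

/-- A multiplicative set of central elements. -/
structure IsCentralFilter (P : Set A) : Prop where
  top_mem : ⊤ ∈ P
  inf_mem : ∀ x ∈ P, ∀ y ∈ P, x ⊓ y ∈ P
  isCentral : ∀ x ∈ P, IsCentral x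

/-- The congruence of a filter of central elements. -/
def IsCentralFilter.setoid {P : Set A} (hP : IsCentralFilter P) (h : IsDMSH A) : Setoid A where
  r x y := ∃ t ∈ P, x ⊓ t = y ⊓ t
  iseqv :=
    { refl := fun _ => ⟨⊤, hP.top_mem, rfl⟩
      symm := fun ⟨t, ht, hxy⟩ => ⟨t, ht, hxy.symm⟩
      trans := fun {x y z} ⟨t, ht, hxy⟩ ⟨s, hs, hyz⟩ => ⟨t ⊓ s, hP.inf_mem t ht s hs, by
        rw [← h.inf_assoc, hxy, h.inf_assoc, h.inf_comm t s, ← h.inf_assoc, hyz, h.inf_assoc]⟩ }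

theorem IsCentralFilter.exists_common {P : Set A} (hP : IsCentralFilter P) (h : IsDMSH A)
    {x y z w : A} (hxy : (hP.setoid h).r x y) (hzw : (hP.setoid h).r z w) :
    ∃ t ∈ P, x ⊓ t = y ⊓ t ∧ z ⊓ t = w ⊓ t := by
  obtain ⟨t, ht, h1⟩ := hxy
  obtain ⟨s, hs, h2⟩ := hzw
  refine ⟨t ⊓ s, hP.inf_mem t ht s hs, ?_, ?_⟩
  · rw [← h.inf_assoc, h1, h.inf_assoc]
  · rw [h.inf_comm t s, ← h.inf_assoc, h2, h.inf_assoc]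

/-- The quotient algebra by the congruence of a filter of central elements. -/
@[reducible]
def IsCentralFilter.quotient {P : Set A} (hP : IsCentralFilter P) (h : IsDMSH A) :
    LAlgebra (Quotient (hP.setoid h)) :=
  letI := h.toDistribLattice
  letI := h.toBoundedOrder
  { max := Quotient.map₂ (· ⊔ ·) (by
      intro x y hxy z w hzw
      obtain ⟨t, ht, h1, h2⟩ := hP.exists_common h hxy hzw
      exact ⟨t, ht, by rw [inf_sup_right, h1, h2, ← inf_sup_right]⟩)
    min := Quotient.map₂ (· ⊓ ·) (by
      intro x y hxy z w hzw
      obtain ⟨t, ht, h1, h2⟩ := hP.exists_common h hxy hzw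
      refine ⟨t, ht, ?_⟩
      rw [inf_inf_distrib_right, h1, h2, ← inf_inf_distrib_right])
    himp := Quotient.map₂ (· ⇨ ·) (by
      intro x y hxy z w hzw
      obtain ⟨t, ht, h1, h2⟩ := hP.exists_common h hxy hzw
      refine ⟨t, ht, ?_⟩
      rw [inf_comm, h.inf_himp_inf, inf_comm t x, inf_comm t z, h1, h2, inf_comm y, inf_comm w,
        ← h.inf_himp_inf, inf_comm])
    bot := Quotient.mk _ ⊥
    top := Quotient.mk _ ⊤
    dneg := Quotient.map dneg (by
      rintro x y ⟨t, ht, h1⟩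
      -- Centrality enters here: the extra term t' ∧ t vanishes.
      have key : ∀ z : A, dneg z ⊓ t = dneg (z ⊓ t) ⊓ t := by
        intro z
        rw [h.dneg_inf, inf_sup_right, inf_comm (dneg t), hP.isCentral t ht]
        exact (sup_bot_eq _).symm
      exact ⟨t, ht, by rw [key x, key y, h1]⟩) }

/-- Every proper multiplicative set is sent to `1` on its central elements by a homomorphism
onto a simple algebra. -/
theorem exists_isCoreSimple_quotient {V : Set Alg.{u}} (hV : IsSubvariety V RUNO1) (A : Alg.{u})
    (hA : A ∈ V) (T : Set A) (hT1 : ⊤ ∈ T) (hTi : ∀ x ∈ T, ∀ y ∈ T, x ⊓ y ∈ T) (hT0 : ⊥ ∉ T) :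
    ∃ (S : Alg.{u}) (p : A → S), S ∈ V ∧ IsCoreSimple S ∧ IsHom p ∧ Function.Surjective p ∧
      ∀ t ∈ T, IsCentral t → p t = ⊤ := by
  have h : IsRUNO1 A := hV.2 hA
  let := h.toDistribLattice
  let := h.toBoundedOrder
  let G : Order.PFilter A := Order.IsPFilter.toPFilter (F := {x : A | ∃ t ∈ T, t ≤ x})
    (Order.IsPFilter.of_def ⟨⊤, ⊤, hT1, le_rfl⟩
      (by
        rintro x ⟨t, ht, htx⟩ y ⟨s, hs, hsy⟩
        exact ⟨t ⊓ s, ⟨t ⊓ s, hTi t ht s hs, le_rfl⟩, inf_le_left.trans htx,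
          inf_le_right.trans hsy⟩)
      (by
        rintro x y hxy ⟨t, ht, htx⟩
        exact ⟨t, ht, htx.trans hxy⟩))
  have hG : ∀ x, x ∈ (G : Set A) ↔ ∃ t ∈ T, t ≤ x := fun x => Iff.rfl
  obtain ⟨J, hJ, -, hGJ⟩ := DistribLattice.prime_ideal_of_disjoint_filter_ideal
    (F := G) (I := Order.Ideal.principal (⊥ : A)) (by
      rw [Set.disjoint_left]
      intro x hx hx'
      obtain ⟨t, ht, htx⟩ := (hG x).mp hx
      have : t = ⊥ := le_bot_iff.mp (htx.trans hx')
      exact hT0 (this ▸ ht))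
  have hTJ : ∀ t ∈ T, t ∉ J := fun t ht htJ =>
    Set.disjoint_left.mp hGJ ((hG t).mpr ⟨t, ht, le_rfl⟩) htJ
  have hP : IsCentralFilter {t : A | IsCentral t ∧ t ∉ J} :=
    { top_mem := ⟨h.isCentral_top, hTJ _ hT1⟩
      inf_mem := fun x hx y hy => ⟨h.isCentral_inf hx.1 hy.1, fun hxy =>
        (hJ.mem_or_mem hxy).elim hx.2 hy.2⟩
      isCentral := fun x hx => hx.1 }
  let := hP.quotient h.toIsDMSH
  let p : A → Quotient (hP.setoid h.toIsDMSH) := Quotient.mk _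
  have hp : IsHom p := ⟨fun _ _ => rfl, fun _ _ => rfl, fun _ _ => rfl, rfl, rfl, fun _ => rfl⟩
  have hsurj : Function.Surjective p := Quotient.mk_surjective
  have hJ0 : (⊥ : A) ∈ J := J.bot_mem
  refine ⟨⟨Quotient (hP.setoid h.toIsDMSH)⟩, p, hV.1.homImage A _ p hA hp hsurj, ⟨?_, ?_⟩, hp,
    hsurj, ?_⟩
  · intro h01
    obtain ⟨t, ht, h1⟩ := Quotient.exact h01
    rw [h.bot_inf, h.inf_comm, h.inf_top] at h1
    exact ht.2 (h1 ▸ hJ0)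
  · intro q hq
    obtain ⟨x, rfl⟩ := hsurj q
    rw [← hp.map_core]
    have hx := h.isCentral_core x
    -- If the core were outside J, it would identify x with 1. Once it is in J, its complement is
    -- outside J and identifies the core with 0.
    have hxJ : core x ∈ J := by
      by_contra hxJ
      refine hq (Quotient.sound ⟨core x, ⟨hx, hxJ⟩, ?_⟩)
      rw [h.core_inf_self, h.inf_comm, h.inf_top]
    have hx' : dneg (core x) ∉ J := by
      intro hx'
      have h1 : core x ⊔ dneg (core x) = ⊤ := by
        have := h.dneg_inf (core x) (dneg (core x))
        rw [hx, h.dneg_bot, h.dneg_dneg, h.sup_comm] at this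
        exact this.symm
      exact hTJ _ hT1 (h1 ▸ Order.Ideal.sup_mem hxJ hx')
    refine Quotient.sound ⟨dneg (core x), ⟨h.isCentral_dneg hx, hx'⟩, ?_⟩
    rw [hx, h.bot_inf]
  · intro t ht htc
    refine Quotient.sound ⟨t, ⟨htc, hTJ t ht⟩, ?_⟩
    rw [h.inf_comm ⊤, h.inf_top]
    exact inf_idem t

end Quotient

/-! ### Separation, extension and amalgamation -/

section Amalgamation

variable {V : Set Alg.{u}}

/-- Homomorphisms onto simple algebras separate points. -/
theorem exists_isCoreSimple_separating (hV : IsSubvariety V RUNO1) (A : Alg.{u}) (hA : A ∈ V)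
    {x y : A} (hxy : x ≠ y) :
    ∃ (S : Alg.{u}) (p : A → S), S ∈ V ∧ IsCoreSimple S ∧ IsHom p ∧ p x ≠ p y := by
  have h : IsRUNO1 A := hV.2 hA
  set t := core (biimp x y) with ht
  have hd : biimp x y ≠ ⊤ := fun hd => hxy (h.eq_of_biimp_eq_top hd)
  have ht1 : t ≠ ⊤ := by
    intro ht1
    have := h.core_inf_self (biimp x y)
    rw [← ht, ht1, h.inf_top] at this
    exact hd this
  have ht0 : dneg t ≠ ⊥ := by
    intro ht0
    apply ht1
    rw [← h.dneg_dneg t, ht0, h.dneg_bot]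
  let := h.toDistribLattice
  -- The filter above t' forces p t' = 1; identifying x and y would make p t = 1 as well.
  obtain ⟨S, p, hSV, hS, hp, -, hpt⟩ := exists_isCoreSimple_quotient hV A hA
    {z | dneg t ⊓ z = dneg t} (h.inf_top _)
    (fun z hz w hw => by
      change dneg t ⊓ (z ⊓ w) = dneg t
      rw [← inf_assoc, hz, hw])
    (fun h0 => ht0 (by
      change dneg t ⊓ ⊥ = dneg t at h0
      rw [← h0, h.inf_comm, h.bot_inf]))
  refine ⟨S, p, hSV, hS, hp, fun hpxy => hS.bot_ne_top ?_⟩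
  have hSR : IsRUNO1 S := hV.2 hSV
  have h1 : dneg (p t) = ⊤ := by
    rw [← hp.map_dneg]
    exact hpt _ (inf_idem _) (h.isCentral_dneg (h.isCentral_core _))
  have h2 : p t = ⊤ := by
    rw [ht, hp.map_core, hp.map_biimp, hpxy, hSR.biimp_self, hSR.core_top]
  rw [← h1, h2, hSR.dneg_top]

/-- Homomorphisms into simple algebras extend along embeddings. -/
theorem exists_extension (hV : IsSubvariety V RUNO1) {A C S : Alg.{u}} (hA : A ∈ V) (hC : C ∈ V)
    (hSV : S ∈ V) (hS : IsCoreSimple S) {u : A → S} (hu : IsHom u) {g : A → C}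
    (hg : IsEmbedding g) : ∃ k : C → S, IsHom k ∧ k ∘ g = u := by
  have hAR : IsRUNO1 A := hV.2 hA
  have hSR : IsRUNO1 S := hV.2 hSV
  obtain ⟨Q, p, hQV, hQ, hp, -, hpt⟩ := exists_isCoreSimple_quotient hV C hC
    (g '' {t | u t = ⊤}) ⟨⊤, hu.map_top, hg.map_top⟩
    (by
      rintro _ ⟨t, ht, rfl⟩ _ ⟨s, hs, rfl⟩
      refine ⟨t ⊓ s, ?_, hg.map_inf t s⟩
      change u (t ⊓ s) = ⊤
      rw [hu.map_inf, ht, hs, hSR.inf_top])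
    (by
      rintro ⟨t, ht, h0⟩
      rw [← hg.map_bot] at h0
      rw [hg.injective h0] at ht
      exact hS.bot_ne_top (hu.map_bot.symm.trans ht))
  have hQR : IsRUNO1 Q := hV.2 hQV
  have hpg : IsHom (p ∘ g) := hp.comp hg.toIsHom
  -- If u separates a and b, then u sends the complement of the core of their equivalence to 1. So
  -- does p ∘ g, which would send it to 0 if it identified a and b.
  obtain ⟨k, hk, hku⟩ := hpg.exists_factor hu (hQR.surjective_of_isCoreSimple hQ hpg) (by
    intro a b hab
    by_contra hne
    have hd : core (u (biimp a b)) = ⊥ := hS.core_eq_bot _ (by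
      rw [hu.map_biimp]
      exact fun hd => hne (hSR.eq_of_biimp_eq_top hd))
    have h1 : u (dneg (core (biimp a b))) = ⊤ := by
      rw [hu.map_dneg, hu.map_core, hd, hSR.dneg_bot]
    have h2 : (p ∘ g) (dneg (core (biimp a b))) = ⊤ :=
      hpt _ ⟨_, h1, rfl⟩ (hg.map_isCentral (hAR.isCentral_dneg (hAR.isCentral_core _)))
    rw [hpg.map_dneg, hpg.map_core, hpg.map_biimp, hab, hQR.biimp_self, hQR.core_top,
      hQR.dneg_top] at h2
    exact hQ.bot_ne_top h2)
  exact ⟨k ∘ p, hk.comp hp, hku⟩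

/-- Every pair of distinct points of `B` is separated by a homomorphism to a simple algebra
that agrees on `A` with a homomorphism of `C`. -/
theorem exists_separating_cocone (hV : IsSubvariety V RUNO1) {A B C : Alg.{u}} (hA : A ∈ V)
    (hB : B ∈ V) (hC : C ∈ V) {f : A → B} {g : A → C} (hf : IsHom f) (hg : IsEmbedding g)
    {x y : B} (hxy : x ≠ y) :
    ∃ (S : Alg.{u}) (p : B → S) (q : C → S),
      S ∈ V ∧ IsHom p ∧ IsHom q ∧ p ∘ f = q ∘ g ∧ p x ≠ p y := by
  obtain ⟨S, p, hSV, hS, hp, hne⟩ := exists_isCoreSimple_separating hV B hB hxy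
  obtain ⟨q, hq, hqp⟩ := exists_extension hV hA hC hSV hS (hp.comp hf) hg
  exact ⟨S, p, q, hSV, hp, hq, hqp.symm, hne⟩

theorem IsHom.pi {ι : Type u} {A : Type u} [LAlgebra A] {S : ι → Alg.{u}}
    {p : ∀ i, A → S i} (hp : ∀ i, IsHom (p i)) :
    IsHom (B := ∀ i, S i) (fun x i => p i x) :=
  ⟨fun x y => funext fun i => (hp i).map_sup x y, fun x y => funext fun i => (hp i).map_inf x y,
    fun x y => funext fun i => (hp i).map_himp x y, funext fun i => (hp i).map_bot,
    funext fun i => (hp i).map_top, fun x => funext fun i => (hp i).map_dneg x⟩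

end Amalgamation

end LAlgebra

open LAlgebra in
theorem corollary4p17 (V : Set LAlgebra.Alg.{u})
    (hV : LAlgebra.IsSubvariety V LAlgebra.RUNO1) : LAlgebra.HasAP V := by
  intro A B C f g hA hB hC hf hg
  -- One factor for each pair to be separated, on either side, makes both maps into the product
  -- injective.
  have key : ∀ i : {b : B × B // b.1 ≠ b.2} ⊕ {c : C × C // c.1 ≠ c.2},
      ∃ (S : Alg.{u}) (p : B → S) (q : C → S), S ∈ V ∧ IsHom p ∧ IsHom q ∧ p ∘ f = q ∘ g ∧
        (∀ b, i = Sum.inl b → p b.1.1 ≠ p b.1.2) ∧ (∀ c, i = Sum.inr c → q c.1.1 ≠ q c.1.2) := by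
    rintro (b | c)
    · obtain ⟨S, p, q, hS, hp, hq, hpq, hne⟩ :=
        exists_separating_cocone hV hA hB hC hf.toIsHom hg b.2
      exact ⟨S, p, q, hS, hp, hq, hpq, by rintro _ ⟨⟩; exact hne,
        by rintro _ ⟨⟩⟩
    · obtain ⟨S, q, p, hS, hq, hp, hpq, hne⟩ :=
        exists_separating_cocone hV hA hC hB hg.toIsHom hf c.2
      exact ⟨S, p, q, hS, hp, hq, hpq.symm, by rintro _ ⟨⟩,
        by rintro _ ⟨⟩; exact hne⟩
  choose S p q hS hp hq hpq hB' hC' using key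
  refine ⟨⟨∀ i, S i⟩, fun x i => p i x, fun x i => q i x, hV.1.product _ S hS,
    ⟨IsHom.pi hp, fun x y hxy => ?_⟩, ⟨IsHom.pi hq, fun x y hxy => ?_⟩,
    funext fun a => funext fun i => congrFun (hpq i) a⟩
  · by_contra hne
    exact hB' _ ⟨(x, y), hne⟩ rfl (congrFun hxy _)
  · by_contra hne
    exact hC' _ ⟨(x, y), hne⟩ rfl (congrFun hxy _)
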